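/- A right-angled Artin group is a group with a presentation of the form $\langle X \mid [x,y]=1 \text{ for all } (x,y)\in\Sigma\rangle$, where $X$ is a finite set, $\Sigma$ is a subset of $X\times X$, and $[x,y]=x^{-1}y^{-1}xy$. For a prime $p$, a group $G$ is residually $p$-finite if for every $g\in G\setminus\{1\}$ there is a quotient of $G$ whose order is a finite power of $p$ and in which the image of $g$ is nontrivial. **Theorem.** Every right-angled Artin group is residually $p$-finite for every prime $p$. -/

import Mathlib

/-- The commutator `[x, y] = x⁻¹ y⁻¹ x y` of two generators, as a word in the free group on `X`. -/
def raagRelator {X : Type*} (x y : X) : FreeGroup X :=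
  (FreeGroup.of x)⁻¹ * (FreeGroup.of y)⁻¹ * FreeGroup.of x * FreeGroup.of y

/-- The group `⟨X | [x, y] = 1 for all (x, y) ∈ S⟩`. -/
abbrev RAAG {X : Type*} (S : Set (X × X)) : Type _ :=
  PresentedGroup {r : FreeGroup X | ∃ x y : X, (x, y) ∈ S ∧ r = raagRelator x y}

/-- A right-angled Artin group is a group that has a presentation
`⟨X | [x, y] = 1 for all (x, y) ∈ S⟩` with `X` finite and `S ⊆ X × X`.
As `X` is finite, it is no restriction that it lives in the lowest universe. -/
def IsRightAngledArtinGroup (G : Type*) [Group G] : Prop :=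
  ∃ (X : Type) (_ : Finite X) (S : Set (X × X)), Nonempty (G ≃* RAAG S)

/-- `G` is residually `p`-finite: every nontrivial element has nontrivial image in some quotient
of `G` whose order is a finite power of `p`. -/
def IsResiduallyPFinite (p : ℕ) (G : Type*) [Group G] : Prop :=
  ∀ g : G, g ≠ 1 → ∃ (N : Subgroup G) (_ : N.Normal),
    (∃ k : ℕ, Nat.card (G ⧸ N) = p ^ k) ∧ QuotientGroup.mk' N g ≠ 1

/-!
Every nontrivial `g` is detected by a unipotent matrix representation over `ZMod (p ^ N)`.

Write `g` as a word `a₁ ^ e₁ ⋯ aₙ ^ eₙ` that cannot be shortened by merging syllables: all `eᵢ` are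
nonzero, and any two occurrences of a letter are separated by a position whose letter does not
commute past it (`exists_reduced_syllableProd`). The positions `1, …, n` form the heap of the word.
Take the free module on the sets of positions, and let a letter `a` act by `1 + X_a`, where `X_a`
adds to a set a position with letter `a` that comes next in the heap order (`Addable`,
`letterMatrix`). Operators of commuting letters commute since adding one position does not affect
whether the other can be added, and `X_a ^ 2 = 0` since between two occurrences of `a` another
position must be added. So `a ↦ 1 + X_a` is a homomorphism on the group (`RAAG.heapHom`), and
`a ^ e` acts by `1 + e X_a`. Each syllable adds at most one position, so the only way from the empty
set to the set of all `n` positions adds them one by one in the order of the word; the matrix of `g`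
therefore has entry `e₁ ⋯ eₙ` there (`prod_take_letterUnit_apply`), which is nonzero modulo `p ^ N`
for large `N`. The matrices that occur are unitriangular for the size of the sets, and over
`ZMod (p ^ N)` these form a finite `p`-group (`isPGroup_sizeUnipotent`).
-/

/-! ### Unipotent elements of a ring -/

/-- A square-zero element `x` of a ring gives the unit `1 + x`, with inverse `1 - x`. -/
def unitOneAdd {R : Type*} [Ring R] (x : R) (hx : x * x = 0) : Rˣ where
  val := 1 + x
  inv := 1 - x
  val_inv := by simp [mul_sub, add_mul, hx]
  inv_val := by simp [mul_add, sub_mul, hx]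

theorem unitOneAdd_zpow {R : Type*} [Ring R] (x : R) (hx : x * x = 0) (e : ℤ) :
    ((unitOneAdd x hx ^ e : Rˣ) : R) = 1 + e • x := by
  have hval : ((unitOneAdd x hx : Rˣ) : R) = 1 + x := rfl
  have hinv : (((unitOneAdd x hx)⁻¹ : Rˣ) : R) = 1 - x := rfl
  induction e using Int.induction_on with
  | zero => simp
  | succ n ih =>
    rw [zpow_add_one, Units.val_mul, ih, hval, mul_add, mul_one, add_mul, one_mul,
      smul_mul_assoc, hx, add_smul]
    simp [add_assoc]
  | pred n ih =>
    rw [zpow_sub_one, Units.val_mul, ih, hinv, mul_sub, mul_one, add_mul, one_mul,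
      smul_mul_assoc, hx, sub_smul]
    simp [add_sub_assoc]

theorem exists_one_add_prime_mul_pow_eq {R : Type*} [Ring R] {p : ℕ} (hp : p.Prime) (b : R)
    (k : ℕ) : ∃ c : R, (1 + p * b) ^ p ^ k = 1 + (p : R) ^ (k + 1) * c := by
  induction k with
  | zero => exact ⟨b, by simp⟩
  | succ k ih =>
    obtain ⟨c, hc⟩ := ih
    obtain ⟨r, hr⟩ := (Commute.one_left ((p : R) ^ (k + 1) * c)).exists_add_pow_prime_eq hp
    have hpc : Commute ((p : R) ^ (k + 1)) c := ((Nat.cast_commute p c).pow_left _)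
    refine ⟨(p : R) ^ ((k + 1) * p - (k + 2)) * c ^ p + c * r, ?_⟩
    have hle : k + 2 ≤ (k + 1) * p := by nlinarith [hp.two_le]
    rw [pow_succ, pow_mul, hc, hr, hpc.mul_pow, ← pow_mul, mul_add, ← mul_assoc _ _ (c ^ p),
      ← pow_add, Nat.add_sub_cancel' hle, pow_succ' (p : R) (k + 1)]
    simp [mul_assoc, add_assoc]

/-- If `p` and `a` are nilpotent, then `1 + a` has `p`-power order: modulo `p` a high `p`-th power
kills `a`, and each further `p`-th power gains a factor `p`. -/
theorem exists_one_add_pow_prime_pow_eq_one {R : Type*} [Ring R] {p N : ℕ} (hp : p.Prime)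
    (hN : (p : R) ^ N = 0) {a : R} (ha : IsNilpotent a) : ∃ k : ℕ, (1 + a) ^ p ^ k = 1 := by
  obtain ⟨s, hs⟩ := ha
  obtain ⟨r, hr⟩ := (Commute.one_left a).exists_add_pow_prime_pow_eq hp s
  obtain ⟨c, hc⟩ := exists_one_add_prime_mul_pow_eq hp (a * r) N
  refine ⟨s + N, ?_⟩
  have h0 : a ^ p ^ s = 0 := pow_eq_zero_of_le (Nat.lt_pow_self hp.one_lt).le hs
  have h1 : (1 + a) ^ p ^ s = 1 + p * (a * r) := by
    rw [hr, h0]; simp [mul_assoc]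
  rw [pow_add, pow_mul, h1, hc, pow_succ, hN]
  simp

/-! ### Matrices that enlarge subsets -/

/-- A matrix indexed by finite sets is size-increasing if its nonzero entries lead from a set to a
set with more elements. -/
def SizeIncreasing {ι R : Type*} [Zero R] (A : Matrix (Finset ι) (Finset ι) R) : Prop :=
  ∀ D D', A D D' ≠ 0 → D.card < D'.card

namespace SizeIncreasing

variable {ι R : Type*} [Ring R] {A B : Matrix (Finset ι) (Finset ι) R}

theorem zero : SizeIncreasing (0 : Matrix (Finset ι) (Finset ι) R) := fun _ _ h => absurd rfl h

theorem neg (hA : SizeIncreasing A) : SizeIncreasing (-A) := fun D D' h =>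
  hA D D' fun h0 => h (by simp [h0])

theorem add (hA : SizeIncreasing A) (hB : SizeIncreasing B) : SizeIncreasing (A + B) := by
  intro D D' h
  by_contra hlt
  exact h (by simp [not_imp_comm.1 (hA D D') hlt, not_imp_comm.1 (hB D D') hlt])

theorem mul [Fintype ι] (hA : SizeIncreasing A) (hB : SizeIncreasing B) : SizeIncreasing (A * B) := by
  intro D D' h
  rw [Matrix.mul_apply] at h
  obtain ⟨E, -, hE⟩ := Finset.exists_ne_zero_of_sum_ne_zero h
  exact (hA D E (left_ne_zero_of_mul hE)).trans (hB E D' (right_ne_zero_of_mul hE))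

theorem isNilpotent [Fintype ι] [DecidableEq ι] (hA : SizeIncreasing A) : IsNilpotent A := by
  have key : ∀ (k : ℕ) (D D' : Finset ι), (A ^ k) D D' ≠ 0 → D.card + k ≤ D'.card := by
    intro k
    induction k with
    | zero =>
      intro D D' h
      rw [pow_zero, Matrix.one_apply] at h
      simp [(ite_ne_right_iff.1 h).1]
    | succ k ih =>
      intro D D' h
      rw [pow_succ, Matrix.mul_apply] at h
      obtain ⟨E, -, hE⟩ := Finset.exists_ne_zero_of_sum_ne_zero h
      have h1 := ih D E (left_ne_zero_of_mul hE)
      have h2 := hA E D' (right_ne_zero_of_mul hE)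
      omega
  refine ⟨Fintype.card ι + 1, ?_⟩
  ext D D'
  by_contra h
  have h1 := key _ D D' h
  have h2 := D'.card_le_univ
  omega

end SizeIncreasing

/-- The invertible matrices `u` for which `u` and `u⁻¹` differ from the identity by a
size-increasing matrix. -/
def sizeUnipotent (ι R : Type*) [Fintype ι] [DecidableEq ι] [Ring R] :
    Subgroup (Matrix (Finset ι) (Finset ι) R)ˣ where
  carrier := {u | SizeIncreasing (u.val - 1) ∧ SizeIncreasing (u⁻¹.val - 1)}
  one_mem' := by simp [SizeIncreasing.zero]
  mul_mem' := by
    have key : ∀ a b : Matrix (Finset ι) (Finset ι) R, SizeIncreasing (a - 1) →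
        SizeIncreasing (b - 1) → SizeIncreasing (a * b - 1) := by
      intro a b ha hb
      have h : a * b - 1 = (a - 1) * (b - 1) + ((a - 1) + (b - 1)) := by noncomm_ring
      exact h ▸ (ha.mul hb).add (ha.add hb)
    rintro u v ⟨hu, hu'⟩ ⟨hv, hv'⟩
    refine ⟨key _ _ hu hv, ?_⟩
    rw [mul_inv_rev]
    exact key _ _ hv' hu'
  inv_mem' := by
    rintro u ⟨hu, hu'⟩
    exact ⟨hu', by rwa [inv_inv]⟩

theorem isPGroup_sizeUnipotent (ι : Type*) {R : Type*} [Fintype ι] [DecidableEq ι] [Ring R]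
    {p N : ℕ} (hp : p.Prime) (hN : (p : R) ^ N = 0) : IsPGroup p (sizeUnipotent ι R) := by
  rintro ⟨u, hu⟩
  have hN' : (p : Matrix (Finset ι) (Finset ι) R) ^ N = 0 := by
    have h := congrArg (Matrix.scalar (Finset ι)) hN
    simpa only [map_pow, map_natCast, map_zero] using h
  obtain ⟨k, hk⟩ := exists_one_add_pow_prime_pow_eq_one hp hN' hu.1.isNilpotent
  refine ⟨k, Subtype.ext (Units.ext ?_)⟩
  simpa using hk

/-! ### The heap representation -/

section Heap

variable {X : Type*} (Γ : SimpleGraph X) {n : ℕ} (lab : Fin n → X)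

/-- The position `k` of the word with letters `lab` can be added to the set `D` of positions: among
the positions whose letters are not joined to `lab k` in the commutation graph `Γ`, the set `D`
contains exactly those before `k`. Distinct occurrences of the same letter count as not joined. -/
def Addable (D : Finset (Fin n)) (k : Fin n) : Prop :=
  k ∉ D ∧ ∀ m, m ≠ k → ¬ Γ.Adj (lab m) (lab k) → (m ∈ D ↔ m < k)

open Classical in
/-- The matrix, indexed by sets of positions, of the partial operation that adds `k`. It acts on
row vectors, so that products of matrices follow the order of letters in a word. -/
noncomputable def stepMatrix (R : Type*) [Ring R] (k : Fin n) :
    Matrix (Finset (Fin n)) (Finset (Fin n)) R :=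
  fun D D' => if Addable Γ lab D k ∧ D' = insert k D then 1 else 0

open Classical in
/-- The operator of a letter `a`: the sum of the steps at the positions with letter `a`. -/
noncomputable def letterMatrix (R : Type*) [Ring R] (a : X) : Matrix (Finset (Fin n)) (Finset (Fin n)) R :=
  ∑ k with lab k = a, stepMatrix Γ lab R k

/-- Any two occurrences of a letter are separated by a position whose letter is not joined to
it in `Γ`. That letter may be the same one, but between consecutive occurrences it is another. -/
def IsSeparated : Prop :=
  ∀ k l, k < l → lab k = lab l → ∃ m, k < m ∧ m < l ∧ ¬ Γ.Adj (lab m) (lab k)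

variable {Γ lab} {R : Type*} [Ring R]

open Classical in
theorem stepMatrix_mul_apply (k l : Fin n) (D D' : Finset (Fin n)) :
    (stepMatrix Γ lab R k * stepMatrix Γ lab R l) D D' =
      if Addable Γ lab D k ∧ Addable Γ lab (insert k D) l ∧ D' = insert l (insert k D)
      then 1 else 0 := by
  rw [Matrix.mul_apply, Finset.sum_eq_single (insert k D)]
  · by_cases h : Addable Γ lab D k <;> simp [stepMatrix, h]
  · intro E _ hE
    simp [stepMatrix, hE]
  · simp

theorem addable_insert_iff {k l : Fin n} (h : Γ.Adj (lab k) (lab l)) (D : Finset (Fin n)) :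
    Addable Γ lab (insert k D) l ↔ Addable Γ lab D l := by
  have hkl : l ≠ k := fun e => Γ.irrefl (e ▸ h)
  unfold Addable
  refine and_congr (by simp [hkl]) (forall_congr' fun m => imp_congr_right fun _ =>
    imp_congr_right fun hm => ?_)
  have hmk : m ≠ k := fun e => hm (e ▸ h)
  simp [hmk]

theorem commute_stepMatrix {k l : Fin n} (h : Γ.Adj (lab k) (lab l)) :
    Commute (stepMatrix Γ lab R k) (stepMatrix Γ lab R l) := by
  classical
  ext D D'
  rw [stepMatrix_mul_apply, stepMatrix_mul_apply, addable_insert_iff h, addable_insert_iff h.symm,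
    Finset.insert_comm]
  congr 1
  rw [and_left_comm]

theorem commute_letterMatrix {a b : X} (h : Γ.Adj a b) :
    Commute (letterMatrix Γ lab R a) (letterMatrix Γ lab R b) := by
  classical
  refine Commute.sum_left _ _ _ fun k hk => Commute.sum_right _ _ _ fun l hl => ?_
  simp only [Finset.mem_filter, Finset.mem_univ, true_and] at hk hl
  exact commute_stepMatrix (by rwa [hk, hl])

theorem letterMatrix_mul_self (hs : IsSeparated Γ lab) (a : X) :
    letterMatrix Γ lab R a * letterMatrix Γ lab R a = 0 := by
  classical
  rw [letterMatrix, Finset.sum_mul_sum]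
  refine Finset.sum_eq_zero fun k hk => Finset.sum_eq_zero fun l hl => ?_
  simp only [Finset.mem_filter, Finset.mem_univ, true_and] at hk hl
  ext D D'
  rw [stepMatrix_mul_apply, if_neg, Matrix.zero_apply]
  rintro ⟨h1, h2, -⟩
  have hlk : lab k = lab l := hk.trans hl.symm
  rcases lt_trichotomy k l with hlt | rfl | hlt
  · -- the separating position lies after `k`, hence is missing, and before `l`, hence is present
    obtain ⟨m, hkm, hml, hm⟩ := hs k l hlt hlk
    have hmD := (h2.2 m hml.ne (hlk ▸ hm)).2 hml
    rw [Finset.mem_insert, or_iff_right hkm.ne'] at hmD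
    exact hkm.not_gt ((h1.2 m hkm.ne' hm).1 hmD)
  · exact h2.1 (Finset.mem_insert_self _ _)
  · refine h2.1 (Finset.mem_insert_of_mem ((h1.2 l hlt.ne ?_).2 hlt))
    rw [hlk]
    exact Γ.irrefl

theorem card_of_letterMatrix_ne_zero {a : X} {D D' : Finset (Fin n)}
    (h : letterMatrix Γ lab R a D D' ≠ 0) : D'.card = D.card + 1 := by
  classical
  rw [letterMatrix, Matrix.sum_apply] at h
  obtain ⟨k, -, hk⟩ := Finset.exists_ne_zero_of_sum_ne_zero h
  obtain ⟨⟨hD, rfl⟩, -⟩ := ite_ne_right_iff.1 hk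
  exact Finset.card_insert_of_notMem hD.1

theorem sizeIncreasing_letterMatrix (a : X) : SizeIncreasing (letterMatrix Γ lab R a) :=
  fun D D' h => by have := card_of_letterMatrix_ne_zero h; omega

/-- From the initial segment before `k`, the letter at `k` can add only the position `k`: earlier
positions are already present and later occurrences of the letter are blocked by separation. -/
theorem letterMatrix_Iio (hs : IsSeparated Γ lab) (k : Fin n) (D : Finset (Fin n)) :
    letterMatrix Γ lab R (lab k) (Finset.Iio k) D = if D = Finset.Iic k then 1 else 0 := by
  classical
  rw [letterMatrix, Matrix.sum_apply, Finset.sum_eq_single k]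
  · have hk : Addable Γ lab (Finset.Iio k) k := ⟨by simp, by simp⟩
    simp [stepMatrix, hk, Finset.Iio_insert]
  · intro l hl hlk
    simp only [Finset.mem_filter, Finset.mem_univ, true_and] at hl
    refine if_neg ?_
    rintro ⟨h1, -⟩
    have hkl : k < l := lt_of_le_of_ne (by simpa using h1.1) hlk.symm
    obtain ⟨m, hkm, hml, hm⟩ := hs k l hkl hl.symm
    have := (h1.2 m hml.ne (hl ▸ hm)).2 hml
    exact hkm.not_gt (Finset.mem_Iio.1 this)
  · simp

variable (R) in
/-- The unit by which a letter acts when occurrences of each letter are separated. -/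
noncomputable def letterUnit (hs : IsSeparated Γ lab) (a : X) :
    (Matrix (Finset (Fin n)) (Finset (Fin n)) R)ˣ :=
  unitOneAdd (letterMatrix Γ lab R a) (letterMatrix_mul_self hs a)

theorem letterUnit_mem (hs : IsSeparated Γ lab) (a : X) :
    letterUnit R hs a ∈ sizeUnipotent (Fin n) R := by
  constructor
  · simpa [letterUnit, unitOneAdd] using sizeIncreasing_letterMatrix a
  · simpa [letterUnit, unitOneAdd] using (sizeIncreasing_letterMatrix (R := R) (Γ := Γ) (lab := lab) a).neg

theorem commute_letterUnit (hs : IsSeparated Γ lab) {a b : X} (h : Γ.Adj a b) :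
    Commute (letterUnit R hs a) (letterUnit R hs b) := by
  refine Units.ext ?_
  have :=  commute_letterMatrix (R := R) (lab := lab) h
  exact ((Commute.one_left _).add_left ((Commute.one_right _).add_right this)).eq

end Heap

/-- The entry that detects a word `w` of syllables. After `k` syllables at most `k` positions have
been added, and `k` positions can only be reached by adding the positions in their order. -/
theorem prod_take_letterUnit_apply {X R : Type*} [Ring R] {Γ : SimpleGraph X} (w : List (X × ℤ))
    (hs : IsSeparated Γ fun i : Fin w.length => w[i].1) (k : ℕ) (hk : k ≤ w.length)
    (D : Finset (Fin w.length)) (hD : k ≤ D.card) :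
    (((w.take k).map fun s => letterUnit R hs s.1 ^ s.2).prod).val ∅ D =
      if D = Finset.univ.filter (fun i => i.val < k) then
        (((w.take k).map Prod.snd).prod : R) else 0 := by
  classical
  induction k generalizing D with
  | zero => simp [Matrix.one_apply, eq_comm]
  | succ k ih =>
    have hk' : k < w.length := hk
    have hIio : Finset.univ.filter (fun i : Fin w.length => i.val < k) = Finset.Iio ⟨k, hk'⟩ := by
      ext i; simp [Fin.lt_def]
    have hIic : Finset.univ.filter (fun i : Fin w.length => i.val < k + 1) =
        Finset.Iic ⟨k, hk'⟩ := by
      ext i; simp [Fin.le_def]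
    have hne : D ≠ Finset.Iio ⟨k, hk'⟩ := by
      rintro rfl
      simp at hD
    have h0 := ih hk'.le D (by omega)
    rw [hIio, if_neg hne] at h0
    rw [List.take_succ_eq_append_getElem hk', List.map_append, List.prod_append, Units.val_mul,
      List.map_singleton, List.prod_singleton, letterUnit, unitOneAdd_zpow, mul_add, mul_one,
      Matrix.add_apply, h0, zero_add, mul_smul_comm, Matrix.smul_apply, Matrix.mul_apply,
      Finset.sum_eq_single (Finset.Iio ⟨k, hk'⟩)]
    · have hX : letterMatrix Γ (fun i : Fin w.length => w[i].1) R w[k].1 (Finset.Iio ⟨k, hk'⟩) D =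
          if D = Finset.Iic ⟨k, hk'⟩ then 1 else 0 := letterMatrix_Iio hs ⟨k, hk'⟩ D
      rw [ih hk'.le _ (by simp), if_pos hIio.symm, hIic]
      rw [hX]
      by_cases hDk : D = Finset.Iic ⟨k, hk'⟩
      · rw [if_pos hDk, if_pos hDk, mul_one, List.map_append, List.prod_append, Int.cast_mul,
          List.map_singleton, List.prod_singleton, zsmul_eq_mul, (Int.cast_commute _ _).eq]
      · simp [hDk]
    · intro E _ hE
      by_cases h : letterMatrix Γ (fun i : Fin w.length => w[i].1) R w[k].1 E D = 0
      · rw [h, mul_zero]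
      · have hcard := card_of_letterMatrix_ne_zero h
        rw [ih hk'.le E (by omega), if_neg (hIio ▸ hE), zero_mul]
    · simp

/-! ### Reduced words -/

/-- The value in a group of a word of syllables `(a, e)`, each read as `f a ^ e`. -/
def syllableProd {X H : Type*} [Group H] (f : X → H) (w : List (X × ℤ)) : H :=
  (w.map fun s => f s.1 ^ s.2).prod

section Reduced

variable {X H : Type*} [Group H] {Γ : SimpleGraph X} {f : X → H}

theorem syllableProd_append (v w : List (X × ℤ)) :
    syllableProd f (v ++ w) = syllableProd f v * syllableProd f w := by
  simp [syllableProd]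

theorem syllableProd_cons (s : X × ℤ) (w : List (X × ℤ)) :
    syllableProd f (s :: w) = f s.1 ^ s.2 * syllableProd f w := by
  simp [syllableProd]

theorem map_syllableProd {K : Type*} [Group K] (φ : H →* K) (w : List (X × ℤ)) :
    φ (syllableProd f w) = syllableProd (fun a => φ (f a)) w := by
  simp [syllableProd, map_list_prod, Function.comp_def]

theorem commute_syllableProd {a : X} {v : List (X × ℤ)} (h : ∀ s ∈ v, Commute (f s.1) (f a))
    (e : ℤ) : Commute (syllableProd f v) (f a ^ e) := by
  refine Commute.list_prod_left _ _ fun x hx => ?_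
  obtain ⟨s, hs, rfl⟩ := List.mem_map.1 hx
  exact (h s hs).zpow_zpow _ _

theorem List.eq_append_getElem_cons_append_getElem_cons {α : Type*} (w : List α) {k l : ℕ}
    (hkl : k < l) (hl : l < w.length) :
    w = w.take k ++ w[k] :: ((w.drop (k + 1)).take (l - (k + 1)) ++ w[l] :: w.drop (l + 1)) := by
  have h : w.drop l = (w.drop (k + 1)).drop (l - (k + 1)) := by
    rw [List.drop_drop, Nat.add_sub_cancel' hkl]
  rw [← List.drop_eq_getElem_cons hl, h, List.take_append_drop,
    ← List.drop_eq_getElem_cons (hkl.trans hl), List.take_append_drop]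

/-- Any word of syllables can be reduced, by deleting trivial syllables and by merging syllables of
the same letter that only commuting letters separate. -/
theorem exists_reduced_syllableProd (hf : ∀ a b, Γ.Adj a b → Commute (f a) (f b))
    (w : List (X × ℤ)) : ∃ v : List (X × ℤ), syllableProd f v = syllableProd f w ∧
      (∀ s ∈ v, s.2 ≠ 0) ∧ IsSeparated Γ fun i : Fin v.length => v[i].1 := by
  induction hn : w.length using Nat.strong_induction_on generalizing w with
  | _ n ih =>
  subst hn
  have reduce : ∀ w' : List (X × ℤ), w'.length < w.length → syllableProd f w' = syllableProd f w →
      ∃ v : List (X × ℤ), syllableProd f v = syllableProd f w ∧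
        (∀ s ∈ v, s.2 ≠ 0) ∧ IsSeparated Γ fun i : Fin v.length => v[i].1 := by
    intro w' hlt heq
    rw [← heq]
    exact ih _ hlt w' rfl
  by_cases h0 : ∀ s ∈ w, s.2 ≠ 0
  · by_cases hs : IsSeparated Γ fun i : Fin w.length => w[i].1
    · exact ⟨w, rfl, h0, hs⟩
    · unfold IsSeparated at hs
      push Not at hs
      obtain ⟨⟨k, hk⟩, ⟨l, hl⟩, hkl, hlab, hadj⟩ := hs
      simp only [Fin.mk_lt_mk, Fin.getElem_fin] at hkl hlab
      have hw := List.eq_append_getElem_cons_append_getElem_cons w hkl hl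
      set v := (w.drop (k + 1)).take (l - (k + 1)) with hv
      have hcomm : ∀ s ∈ v, Commute (f s.1) (f w[k].1) := by
        intro s hsv
        obtain ⟨i, hi, rfl⟩ := List.mem_iff_getElem.1 hsv
        have hi' := hi
        simp only [hv, List.length_take, List.length_drop] at hi'
        have := hadj ⟨k + 1 + i, by omega⟩ (Fin.mk_lt_mk.2 (by omega)) (Fin.mk_lt_mk.2 (by omega))
        simp only [hv, List.getElem_take, List.getElem_drop]
        exact hf _ _ this
      refine reduce (w.take k ++ (w[k].1, w[k].2 + w[l].2) :: (v ++ w.drop (l + 1))) ?_ ?_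
      · conv_rhs => rw [hw]
        simp only [List.length_append, List.length_cons]
        omega
      · conv_rhs => rw [hw]
        simp only [syllableProd_append, syllableProd_cons, ← hlab]
        rw [← mul_assoc (syllableProd f v), (commute_syllableProd hcomm _).eq, zpow_add]
        simp only [mul_assoc]
  · push Not at h0
    obtain ⟨s, hs, hs0⟩ := h0
    obtain ⟨u, v, rfl⟩ := List.append_of_mem hs
    exact reduce (u ++ v) (by simp) (by simp [syllableProd_append, syllableProd_cons, hs0])

end Reduced

/-! ### Residual finiteness -/

theorem exists_quotient_of_hom_isPGroup {G H : Type*} [Group G] [Group H] {p : ℕ} (hp : p.Prime)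
    {P : Subgroup H} [Finite P] (hP : IsPGroup p P) (φ : G →* H) (hφ : ∀ x, φ x ∈ P) {g : G}
    (hg : φ g ≠ 1) : ∃ (N : Subgroup G) (_ : N.Normal),
      (∃ k : ℕ, Nat.card (G ⧸ N) = p ^ k) ∧ QuotientGroup.mk' N g ≠ 1 := by
  have : Fact p.Prime := ⟨hp⟩
  have hle : φ.range ≤ P := by rintro _ ⟨x, rfl⟩; exact hφ x
  have : Finite φ.range := Finite.of_injective _ (Subgroup.inclusion_injective hle)
  refine ⟨φ.ker, inferInstance, ?_, ?_⟩
  · obtain ⟨k, hk⟩ := IsPGroup.iff_card.1 (hP.to_le hle)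
    exact ⟨k, by rw [Nat.card_congr (QuotientGroup.quotientKerEquivRange φ).toEquiv, hk]⟩
  · rwa [QuotientGroup.mk'_apply, ne_eq, QuotientGroup.eq_one_iff]

namespace RAAG

variable {X : Type*} {S : Set (X × X)}

theorem adj_fromRel_iff {a b : X} :
    (SimpleGraph.fromRel fun x y => (x, y) ∈ S).Adj a b ↔ a ≠ b ∧ ((a, b) ∈ S ∨ (b, a) ∈ S) :=
  SimpleGraph.fromRel_adj _ _ _

theorem lift_raagRelator_eq_one_iff {H : Type*} [Group H] (f : X → H) (x y : X) :
    FreeGroup.lift f (raagRelator x y) = 1 ↔ Commute (f x) (f y) := by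
  simp only [raagRelator, map_mul, map_inv, FreeGroup.lift_apply_of]
  rw [← mul_inv_rev, mul_assoc, inv_mul_eq_one, eq_comm]
  rfl

theorem commute_of {a b : X} (h : (SimpleGraph.fromRel fun x y => (x, y) ∈ S).Adj a b) :
    Commute (PresentedGroup.of a : RAAG S) (PresentedGroup.of b) := by
  have key : ∀ x y, (x, y) ∈ S → Commute (PresentedGroup.of x : RAAG S) (PresentedGroup.of y) := by
    intro x y hxy
    rw [← lift_raagRelator_eq_one_iff]
    have h : FreeGroup.lift (fun x => (PresentedGroup.of x : RAAG S)) =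
        PresentedGroup.mk _ := by
      ext x
      simp [PresentedGroup.of]
    rw [h]
    exact PresentedGroup.one_of_mem ⟨x, y, hxy, rfl⟩
  rcases (adj_fromRel_iff.1 h).2 with h | h
  · exact key _ _ h
  · exact (key _ _ h).symm

theorem exists_syllableProd (g : RAAG S) :
    ∃ w : List (X × ℤ), syllableProd (fun a => (PresentedGroup.of a : RAAG S)) w = g := by
  have hg : g ∈ Subgroup.closure (Set.range (PresentedGroup.of : X → RAAG S)) := by
    rw [PresentedGroup.closure_range_of]
    trivial
  induction hg using Subgroup.closure_induction_left with
  | one => exact ⟨[], rfl⟩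
  | mul_left x hx y _ ih =>
    obtain ⟨a, rfl⟩ := hx
    obtain ⟨w, rfl⟩ := ih
    exact ⟨(a, 1) :: w, by simp [syllableProd_cons]⟩
  | inv_mul_cancel x hx y _ ih =>
    obtain ⟨a, rfl⟩ := hx
    obtain ⟨w, rfl⟩ := ih
    exact ⟨(a, -1) :: w, by simp [syllableProd_cons]⟩

/-- The homomorphism to unipotent matrices given by a word with separated letters. -/
noncomputable def heapHom (R : Type*) [Ring R] {n : ℕ} {lab : Fin n → X}
    (hs : IsSeparated (SimpleGraph.fromRel fun x y => (x, y) ∈ S) lab) :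
    RAAG S →* (Matrix (Finset (Fin n)) (Finset (Fin n)) R)ˣ :=
  PresentedGroup.toGroup (f := letterUnit R hs) <| by
    rintro _ ⟨x, y, hxy, rfl⟩
    rw [lift_raagRelator_eq_one_iff]
    by_cases h : x = y
    · exact h ▸ Commute.refl _
    · exact commute_letterUnit hs (adj_fromRel_iff.2 ⟨h, Or.inl hxy⟩)

theorem heapHom_of (R : Type*) [Ring R] {n : ℕ} {lab : Fin n → X}
    (hs : IsSeparated (SimpleGraph.fromRel fun x y => (x, y) ∈ S) lab) (a : X) :
    heapHom R hs (PresentedGroup.of a) = letterUnit R hs a :=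
  PresentedGroup.toGroup.of _

theorem heapHom_mem (R : Type*) [Ring R] {n : ℕ} {lab : Fin n → X}
    (hs : IsSeparated (SimpleGraph.fromRel fun x y => (x, y) ∈ S) lab) (g : RAAG S) :
    heapHom R hs g ∈ sizeUnipotent (Fin n) R := by
  obtain ⟨w, rfl⟩ := exists_syllableProd g
  rw [map_syllableProd]
  refine Subgroup.list_prod_mem _ fun x hx => ?_
  obtain ⟨s, -, rfl⟩ := List.mem_map.1 hx
  simp only [heapHom_of]
  exact zpow_mem (letterUnit_mem hs _) _

theorem isResiduallyPFinite (S : Set (X × X)) {p : ℕ} (hp : p.Prime) :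
    IsResiduallyPFinite p (RAAG S) := by
  intro g hg
  obtain ⟨w₀, rfl⟩ := exists_syllableProd g
  obtain ⟨w, hw, h0, hs⟩ := exists_reduced_syllableProd (fun _ _ => commute_of) w₀
  rw [← hw] at hg ⊢
  set m : ℤ := (w.map Prod.snd).prod with hm
  have hm0 : m ≠ 0 := by
    refine List.prod_ne_zero fun h => ?_
    obtain ⟨s, hs, hs0⟩ := List.mem_map.1 h
    exact h0 s hs hs0
  -- a modulus `p ^ N` that does not divide the product of the exponents
  have hN : ((m : ℤ) : ZMod (p ^ m.natAbs)) ≠ 0 := by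
    rw [ne_eq, ZMod.intCast_zmod_eq_zero_iff_dvd]
    intro h
    have := Nat.le_of_dvd (Int.natAbs_pos.2 hm0) (Int.natCast_dvd.1 h)
    exact this.not_gt (Nat.lt_pow_self hp.one_lt)
  have : NeZero (p ^ m.natAbs) := ⟨pow_ne_zero _ hp.ne_zero⟩
  have : Finite (Matrix (Finset (Fin w.length)) (Finset (Fin w.length))
    (ZMod (p ^ m.natAbs)))ˣ := inferInstance
  refine exists_quotient_of_hom_isPGroup hp
    (isPGroup_sizeUnipotent (Fin w.length) (N := m.natAbs) hp ?_)
    (heapHom (ZMod (p ^ m.natAbs)) hs) (heapHom_mem _ hs) fun h => ?_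
  · exact_mod_cast ZMod.natCast_self (p ^ m.natAbs)
  · have key := prod_take_letterUnit_apply (R := ZMod (p ^ m.natAbs)) w hs w.length le_rfl
      Finset.univ (by simp)
    have hne : w ≠ [] := by
      rintro rfl
      exact hg rfl
    have : Nonempty (Fin w.length) := ⟨⟨0, List.length_pos_iff.2 hne⟩⟩
    rw [map_syllableProd] at h
    simp only [heapHom_of, syllableProd] at h
    rw [List.take_length, h, if_pos (by ext i; simp), ← hm, Units.val_one, Matrix.one_apply_ne
      Finset.univ_nonempty.ne_empty.symm] at key
    exact hN key.symm

end RAAG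

theorem theorem2p11 (G : Type*) [Group G] (hG : IsRightAngledArtinGroup G)
    (p : ℕ) (hp : p.Prime) : IsResiduallyPFinite p G := by
  obtain ⟨X, -, S, ⟨φ⟩⟩ := hG
  intro g hg
  obtain ⟨N, hN, ⟨k, hk⟩, hgN⟩ := RAAG.isResiduallyPFinite S hp (φ g) (by simpa using hg)
  refine ⟨N.comap φ.toMonoidHom, inferInstance, ⟨k, ?_⟩, ?_⟩
  · rw [← hk]
    exact Subgroup.index_comap_of_surjective N φ.surjective
  · rw [QuotientGroup.mk'_apply, ne_eq, QuotientGroup.eq_one_iff] at hgN ⊢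
    exact hgN
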